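/- Let $d\ge 1$, let $\Omega\subset\mathbb R^d$ be a bounded open convex set (for instance a uniformly convex domain), let $f\in C(\bar\Omega)$ with $f\ge 0$, and let $g\in C(\partial\Omega)$. A triangulation of $\Omega$ means a finite conforming simplicial complex $\mathcal T_h$ in $\mathbb R^d$, each of whose faces is a face of a nondegenerate $d$-simplex of the complex, with all nodes in $\bar\Omega$, such that the nodes on the boundary of the triangulated region $\bar\Omega_h=\bigcup_{T\in\mathcal T_h}T$ lie on $\partial\Omega$. It is quasiuniform with mesh size $h>0$ and constant $\sigma>0$ if each of its $d$-simplices has diameter at most $h$ and contains a closed ball of radius $h/\sigma$. Let $\Omega_h^i$ and $\Omega_h^b$ be the sets of nodes in the interior and on the boundary of $\bar\Omega_h$, respectively, and let $X_h$ be the space of continuous functions on $\bar\Omega_h$ that are affine on each simplex. For $\delta>0$, $x_h\in\Omega_h^i$, a unit vector $w$ and $v\in X_h$ put $$\nabla^2_{\delta w}v(x_h)=\frac{v(x_h+\rho\delta w)-2v(x_h)+v(x_h-\rho\delta w)}{\rho^2\delta^2},$$ where $\rho\in(0,1]$ is the largest number with $x_h\pm\rho\delta w\in\bar\Omega_h$.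 For $\theta>0$ let $\mathcal V_\theta$ be a set of $d$-tuples of unit vectors (not necessarily orthogonal) such that for every orthonormal basis $(w_i)_{i=1}^d$ of $\mathbb R^d$ there is $(w_i^\theta)_{i=1}^d\in\mathcal V_\theta$ with $\max_i|w_i-w_i^\theta|\le\theta$. Define $$\mathrm{MA}_{h,\delta,\theta}[v](x_h)=\inf_{(w_i)\in\mathcal V_\theta}\Big[\prod_{i=1}^d\big(\nabla^2_{\delta w_i}v(x_h)\big)^+-\sum_{i=1}^d\big(\nabla^2_{\delta w_i}v(x_h)\big)^-\Big],$$ with $t^+=\max\{t,0\}$ and $t^-=\max\{-t,0\}$; the infimum is a minimum if $\mathcal V_\theta$ is finite. The two scale scheme asks for $u\in X_h$ with $$\mathrm{MA}_{h,\delta,\theta}[u](x_h)=f(x_h)\quad\forall x_h\in\Omega_h^i,\qquad u(x_h)=g(x_h)\quad\forall x_h\in\Omega_h^b.$$ Theorem (existence and stability). For every $\varepsilon=(h,\delta,\theta)$ with $h,\delta,\theta>0$, every quasiuniform triangulation $\mathcal T_h$ of $\Omega$ with mesh size $h$, and every $\mathcal V_\theta$ as above, the two scale scheme has a solution $u_h^\varepsilon\in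 X_h$. Moreover, there is a constant $C$, depending only on $d$, $\Omega$, $f$ and $g$ (and not on $\varepsilon$, the triangulation, its constant $\sigma$, or $\mathcal V_\theta$), such that every solution satisfies $|u_h^\varepsilon(x)|\le C$ for all $x\in\bar\Omega_h$; that is, $\|u_h^\varepsilon\|_{L^\infty(\Omega_h)}\le C$. -/

import Mathlib

open Set

noncomputable section

namespace TwoScale

/-- `T` is a simplicial triangulation of the domain `Ω ⊆ ℝᵈ`: a finite conforming simplicial
complex, each face of which is a face of a nondegenerate `d`-simplex of the complex, with all nodes
in `closure Ω`, such that the nodes on the boundary of the triangulated region `T.space` lie on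
the boundary of `Ω`. (The triangulated region of a curved domain need not fill up `Ω`.) -/
structure IsTriangulation {d : ℕ} (Ω : Set (EuclideanSpace ℝ (Fin d)))
    (T : Geometry.SimplicialComplex ℝ (EuclideanSpace ℝ (Fin d))) : Prop where
  finite_faces : T.faces.Finite
  pure : ∀ s ∈ T.faces, ∃ t ∈ T.faces, s ⊆ t ∧ t.card = d + 1
  nodes_subset : T.vertices ⊆ closure Ω
  boundary_nodes : ∀ x ∈ T.vertices, x ∈ frontier T.space → x ∈ frontier Ω

/-- Quasiuniformity with mesh size `h` and constant `σ`: each simplex has diameter at most `h` and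
contains a ball of radius `h / σ`. -/
def IsQuasiUniform {d : ℕ} (T : Geometry.SimplicialComplex ℝ (EuclideanSpace ℝ (Fin d)))
    (h σ : ℝ) : Prop :=
  ∀ s ∈ T.facets,
    Metric.diam (convexHull ℝ (s : Set (EuclideanSpace ℝ (Fin d)))) ≤ h ∧
      ∃ c, Metric.closedBall c (h / σ) ⊆ convexHull ℝ (s : Set (EuclideanSpace ℝ (Fin d)))

/-- The interior nodes of the triangulation. -/
def interiorNodes {d : ℕ} (T : Geometry.SimplicialComplex ℝ (EuclideanSpace ℝ (Fin d))) :
    Set (EuclideanSpace ℝ (Fin d)) :=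
  T.vertices ∩ interior T.space

/-- The boundary nodes of the triangulation. -/
def boundaryNodes {d : ℕ} (T : Geometry.SimplicialComplex ℝ (EuclideanSpace ℝ (Fin d))) :
    Set (EuclideanSpace ℝ (Fin d)) :=
  T.vertices ∩ frontier T.space

/-- Membership in the space `X_h` of continuous piecewise linear functions over the triangulation.
Only the values of `v` on the triangulated region `T.space` matter. -/
def IsPiecewiseLinear {d : ℕ} (T : Geometry.SimplicialComplex ℝ (EuclideanSpace ℝ (Fin d)))
    (v : EuclideanSpace ℝ (Fin d) → ℝ) : Prop :=
  ContinuousOn v T.space ∧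
    ∀ s ∈ T.faces, ∃ A : EuclideanSpace ℝ (Fin d) →ᵃ[ℝ] ℝ,
      EqOn v A (convexHull ℝ (s : Set (EuclideanSpace ℝ (Fin d))))

/-- The largest `ρ ∈ (0, 1]` with `x ± ρ δ w ∈ K` (the maximum is attained when `K` is
compact, `x` is interior to `K` and `0 < δ`). -/
def stepFraction {d : ℕ} (K : Set (EuclideanSpace ℝ (Fin d))) (δ : ℝ)
    (x w : EuclideanSpace ℝ (Fin d)) : ℝ :=
  sSup {ρ : ℝ | 0 < ρ ∧ ρ ≤ 1 ∧ x + (ρ * δ) • w ∈ K ∧ x - (ρ * δ) • w ∈ K}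

/-- The centered second difference of `v` at `x` in the direction `w` at scale `δ`, with the step
reduced so that the stencil stays in `K`. -/
def secondDiff {d : ℕ} (K : Set (EuclideanSpace ℝ (Fin d))) (δ : ℝ)
    (v : EuclideanSpace ℝ (Fin d) → ℝ) (x w : EuclideanSpace ℝ (Fin d)) : ℝ :=
  (v (x + (stepFraction K δ x w * δ) • w) - 2 * v x + v (x - (stepFraction K δ x w * δ) • w)) /
    (stepFraction K δ x w ^ 2 * δ ^ 2)

/-- `V` is a directional discretization with parameter `θ`: a set of `d`-tuples of unit vectors
(not necessarily orthogonal) such that each orthonormal basis is within `θ` of one of them. -/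
structure IsDirectionSet {d : ℕ} (θ : ℝ) (V : Set (Fin d → EuclideanSpace ℝ (Fin d))) : Prop where
  unit : ∀ w ∈ V, ∀ i, ‖w i‖ = 1
  approx : ∀ b : Fin d → EuclideanSpace ℝ (Fin d), Orthonormal ℝ b →
    ∃ w ∈ V, ∀ i, ‖b i - w i‖ ≤ θ

/-- The two scale Monge–Ampère operator. For finite `V` the infimum is a minimum. -/
def maOp {d : ℕ} (K : Set (EuclideanSpace ℝ (Fin d))) (δ : ℝ)
    (V : Set (Fin d → EuclideanSpace ℝ (Fin d))) (v : EuclideanSpace ℝ (Fin d) → ℝ)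
    (x : EuclideanSpace ℝ (Fin d)) : ℝ :=
  sInf ((fun w : Fin d → EuclideanSpace ℝ (Fin d) =>
    (∏ i, max (secondDiff K δ v x (w i)) 0) - ∑ i, max (-secondDiff K δ v x (w i)) 0) '' V)

/-- `u` solves the two scale scheme with right hand side `f` and boundary datum `g`. -/
structure IsSolution {d : ℕ} (T : Geometry.SimplicialComplex ℝ (EuclideanSpace ℝ (Fin d)))
    (δ : ℝ) (V : Set (Fin d → EuclideanSpace ℝ (Fin d))) (f g : EuclideanSpace ℝ (Fin d) → ℝ)
    (u : EuclideanSpace ℝ (Fin d) → ℝ) : Prop where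
  piecewiseLinear : IsPiecewiseLinear T u
  interior_eq : ∀ x ∈ interiorNodes T, maOp T.space δ V u x = f x
  boundary_eq : ∀ x ∈ boundaryNodes T, u x = g x

end TwoScale

end

/-! ### Piecewise linear functions and nodal interpolation. -/

namespace TwoScale

variable {d : ℕ} {T : Geometry.SimplicialComplex ℝ (EuclideanSpace ℝ (Fin d))}

/-! The scheme is monotone: raising `v` away from a node where its value is kept raises every second
difference there (`secondDiff_mono`). Existence is Perron's method: among subsolutions, the nodal
vector with the largest sum is a solution, since any node with strict inequality could be raised a
little.

Both bounds compare with `Q`, the interpolant of `a / 2 * ‖x‖ ^ 2`, whose second differences are at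
least `a` in every direction and at every scale (`le_secondDiff_interpolant`). Since `f ≥ 0`, all
second differences of a solution `u` in directions from `V` are nonnegative, so the discrete maximum
principle applies to `u + Q`. Since `f < a ^ d`, some second difference is below `a`, so it applies
to `Q - u`. No comparison principle between two solutions is needed, and mesh, scale and directions
do not enter the constants. -/

theorem IsTriangulation.finite_vertices {Ω : Set (EuclideanSpace ℝ (Fin d))}
    (hT : IsTriangulation Ω T) : T.vertices.Finite := by
  rw [Geometry.SimplicialComplex.vertices_eq]
  exact hT.finite_faces.biUnion fun s _ => s.finite_toSet

theorem IsTriangulation.isCompact_space {Ω : Set (EuclideanSpace ℝ (Fin d))}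
    (hT : IsTriangulation Ω T) : IsCompact T.space :=
  hT.finite_faces.isCompact_biUnion fun s _ => s.finite_toSet.isCompact_convexHull ℝ

/-- Two affine maps that agree on a set agree on its convex hull. -/
theorem eqOn_convexHull {E F : Type*} [AddCommGroup E] [Module ℝ E] [AddCommGroup F] [Module ℝ F]
    {A B : E →ᵃ[ℝ] F} {s : Set E} (h : EqOn A B s) : EqOn A B (convexHull ℝ s) := by
  have hc : Convex ℝ ((A - B) ⁻¹' {0}) := (convex_singleton (0 : F)).affine_preimage (A - B)
  have : convexHull ℝ s ⊆ (A - B) ⁻¹' {0} :=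
    convexHull_min (fun x hx => by simp [h hx]) hc
  intro x hx
  have := this hx
  simpa [sub_eq_zero] using this

/-- An affine map with prescribed values at the vertices of a nondegenerate `d`-simplex. -/
theorem exists_affineMap_eqOn {t : Finset (EuclideanSpace ℝ (Fin d))}
    (ht : AffineIndependent ℝ ((↑) : t → EuclideanSpace ℝ (Fin d))) (hcard : t.card = d + 1)
    (c : EuclideanSpace ℝ (Fin d) → ℝ) :
    ∃ A : EuclideanSpace ℝ (Fin d) →ᵃ[ℝ] ℝ, EqOn A c t := by
  classical
  have htop : affineSpan ℝ (range ((↑) : t → EuclideanSpace ℝ (Fin d))) = ⊤ :=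
    ht.affineSpan_eq_top_iff_card_eq_finrank_add_one.2 (by simp [hcard])
  let b : AffineBasis t ℝ (EuclideanSpace ℝ (Fin d)) := ⟨(↑), ht, htop⟩
  refine ⟨∑ i : t, c i • b.coord i, fun x hx => ?_⟩
  have hb : ∀ i : t, b.coord i x = if i = ⟨x, hx⟩ then 1 else 0 := fun i =>
    b.coord_apply i ⟨x, hx⟩
  have : (∑ i : t, c i • b.coord i) x = ∑ i : t, c i * b.coord i x := by
    induction (Finset.univ : Finset t) using Finset.induction_on with
    | empty => simp
    | insert a s ha ih => simp [Finset.sum_insert ha, ih]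
  rw [this]
  simp [hb]

theorem isPiecewiseLinear_affine (A : EuclideanSpace ℝ (Fin d) →ᵃ[ℝ] ℝ) :
    IsPiecewiseLinear T A :=
  ⟨A.continuous_of_finiteDimensional.continuousOn, fun _ _ => ⟨A, fun _ _ => rfl⟩⟩

theorem isPiecewiseLinear_const (r : ℝ) : IsPiecewiseLinear T fun _ => r :=
  isPiecewiseLinear_affine (AffineMap.const ℝ _ r)

theorem IsPiecewiseLinear.add {u v : EuclideanSpace ℝ (Fin d) → ℝ} (hu : IsPiecewiseLinear T u)
    (hv : IsPiecewiseLinear T v) : IsPiecewiseLinear T (u + v) := by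
  refine ⟨hu.1.add hv.1, fun s hs => ?_⟩
  obtain ⟨A, hA⟩ := hu.2 s hs
  obtain ⟨B, hB⟩ := hv.2 s hs
  exact ⟨A + B, fun x hx => by simp [hA hx, hB hx]⟩

theorem IsPiecewiseLinear.smul {u : EuclideanSpace ℝ (Fin d) → ℝ} (r : ℝ)
    (hu : IsPiecewiseLinear T u) : IsPiecewiseLinear T (r • u) := by
  refine ⟨hu.1.const_smul r, fun s hs => ?_⟩
  obtain ⟨A, hA⟩ := hu.2 s hs
  exact ⟨r • A, fun x hx => by simp [hA hx]⟩

theorem IsPiecewiseLinear.sub {u v : EuclideanSpace ℝ (Fin d) → ℝ} (hu : IsPiecewiseLinear T u)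
    (hv : IsPiecewiseLinear T v) : IsPiecewiseLinear T (u - v) := by
  simpa [sub_eq_add_neg] using hu.add (hv.smul (-1))

theorem IsPiecewiseLinear.nonneg {v : EuclideanSpace ℝ (Fin d) → ℝ} (hv : IsPiecewiseLinear T v)
    (h : ∀ z ∈ T.vertices, 0 ≤ v z) : ∀ x ∈ T.space, 0 ≤ v x := by
  intro x hx
  obtain ⟨s, hs, hxs⟩ := Geometry.SimplicialComplex.mem_space_iff.1 hx
  obtain ⟨A, hA⟩ := hv.2 s hs
  have hsub : convexHull ℝ (s : Set (EuclideanSpace ℝ (Fin d))) ⊆ A ⁻¹' Ici 0 := by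
    refine convexHull_min (fun y hy => ?_) ((convex_Ici (0 : ℝ)).affine_preimage A)
    have hyv : y ∈ T.vertices :=
      T.down_closed hs (Finset.singleton_subset_iff.2 hy) (Finset.singleton_nonempty y)
    rw [mem_preimage, ← hA (subset_convexHull ℝ _ hy)]
    exact h y hyv
  rw [hA hxs]
  exact hsub hxs

theorem IsPiecewiseLinear.le_of_vertices {u v : EuclideanSpace ℝ (Fin d) → ℝ}
    (hu : IsPiecewiseLinear T u) (hv : IsPiecewiseLinear T v)
    (h : ∀ z ∈ T.vertices, u z ≤ v z) : ∀ x ∈ T.space, u x ≤ v x := fun x hx =>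
  sub_nonneg.1 ((hv.sub hu).nonneg (fun z hz => sub_nonneg.2 (h z hz)) x hx)

/-- Nodal values can be interpolated by a piecewise linear function. -/
theorem exists_interpolant {Ω : Set (EuclideanSpace ℝ (Fin d))} (hT : IsTriangulation Ω T)
    (c : EuclideanSpace ℝ (Fin d) → ℝ) :
    ∃ v, IsPiecewiseLinear T v ∧ ∀ z ∈ T.vertices, v z = c z := by
  classical
  have hA : ∀ s ∈ T.faces, ∃ A : EuclideanSpace ℝ (Fin d) →ᵃ[ℝ] ℝ, EqOn A c s := by
    intro s hs
    obtain ⟨t, ht, hst, hcard⟩ := hT.pure s hs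
    obtain ⟨A, hA⟩ := exists_affineMap_eqOn (T.indep ht) hcard c
    exact ⟨A, hA.mono (by exact_mod_cast hst)⟩
  choose! A hA using hA
  have hF : ∀ x ∈ T.space, ∃ s ∈ T.faces, x ∈ convexHull ℝ (s : Set _) := fun x hx =>
    Geometry.SimplicialComplex.mem_space_iff.1 hx
  choose! F hF hxF using hF
  have key : ∀ s ∈ T.faces, EqOn (fun x => A (F x) x) (A s) (convexHull ℝ (s : Set _)) := by
    intro s hs x hx
    have hxK := Geometry.SimplicialComplex.convexHull_subset_space hs hx
    -- Conformity: two faces meet within the hull of their common vertices, where both affine pieces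
    -- take the values `c`.
    refine eqOn_convexHull (fun y hy => ?_)
      (T.inter_subset_convexHull (hF x hxK) hs ⟨hxF x hxK, hx⟩)
    rw [hA _ (hF x hxK) hy.1, hA s hs hy.2]
  refine ⟨fun x => A (F x) x, ⟨?_, fun s hs => ⟨A s, key s hs⟩⟩, fun z hz => ?_⟩
  · have : Finite T.faces := hT.finite_faces
    have hK : T.space = ⋃ s : T.faces, convexHull ℝ (s.1 : Set (EuclideanSpace ℝ (Fin d))) := by
      rw [Geometry.SimplicialComplex.space, biUnion_eq_iUnion]
    rw [hK]
    refine (locallyFinite_of_finite _).continuousOn_iUnion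
      (fun s => (s.1.finite_toSet.isCompact_convexHull ℝ).isClosed) fun s => ?_
    exact (A s).continuous_of_finiteDimensional.continuousOn.congr (key s s.2)
  · rw [key {z} hz (subset_convexHull ℝ _ (by simp))]
    exact hA {z} hz (by simp)

/-- The nodal interpolation operator. -/
theorem exists_interpolation {Ω : Set (EuclideanSpace ℝ (Fin d))} (hT : IsTriangulation Ω T) :
    ∃ I : (EuclideanSpace ℝ (Fin d) → ℝ) →ₗ[ℝ] (EuclideanSpace ℝ (Fin d) → ℝ),
      (∀ c, IsPiecewiseLinear T (I c)) ∧ (∀ c, ∀ z ∈ T.vertices, I c z = c z) ∧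
        Continuous I := by
  classical
  have h := fun z => exists_interpolant hT (Pi.single z (1 : ℝ))
  choose φ hφ hφv using h
  have hfin := hT.finite_vertices
  refine ⟨∑ z ∈ hfin.toFinset, (LinearMap.proj z).smulRight (φ z), fun c => ?_,
    fun c y hy => ?_, ?_⟩
  · have : ∀ N : Finset (EuclideanSpace ℝ (Fin d)), IsPiecewiseLinear T (∑ z ∈ N, c z • φ z) := by
      intro N
      induction N using Finset.induction_on with
      | empty => exact isPiecewiseLinear_const 0
      | insert a s ha ih => rw [Finset.sum_insert ha]; exact ((hφ a).smul _).add ih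
    simpa [LinearMap.sum_apply] using this hfin.toFinset
  · simp only [LinearMap.sum_apply, LinearMap.smulRight_apply, LinearMap.proj_apply,
      Finset.sum_apply, Pi.smul_apply, smul_eq_mul]
    rw [Finset.sum_eq_single y]
    · simp [hφv y y hy]
    · intro z _ hzy
      simp [hφv z y hy, Pi.single_eq_of_ne hzy.symm]
    · intro hn
      exact absurd (hfin.mem_toFinset.2 hy) hn
  · simp only [LinearMap.coe_sum, LinearMap.coe_smulRight, LinearMap.proj_apply]
    refine continuous_pi fun x => ?_
    simp only [Finset.sum_apply, Pi.smul_apply, smul_eq_mul]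
    fun_prop

end TwoScale

/-! ### Second differences, discrete maximum principle and barriers. -/

namespace TwoScale

variable {d : ℕ} {T : Geometry.SimplicialComplex ℝ (EuclideanSpace ℝ (Fin d))}
  {K : Set (EuclideanSpace ℝ (Fin d))} {δ : ℝ} {x w : EuclideanSpace ℝ (Fin d)}

theorem le_stepFraction {ρ : ℝ} (h0 : 0 < ρ) (h1 : ρ ≤ 1) (hp : x + (ρ * δ) • w ∈ K)
    (hm : x - (ρ * δ) • w ∈ K) : ρ ≤ stepFraction K δ x w :=
  le_csSup ⟨1, fun _ h => h.2.1⟩ ⟨h0, h1, hp, hm⟩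

theorem exists_pos_admissible (hδ : 0 < δ) (hx : x ∈ interior K) :
    ∃ r : ℝ, 0 < r ∧ r ≤ 1 ∧ ∀ w : EuclideanSpace ℝ (Fin d), ‖w‖ = 1 →
      x + (r * δ) • w ∈ K ∧ x - (r * δ) • w ∈ K := by
  obtain ⟨e, he, hball⟩ := Metric.mem_nhds_iff.1 (mem_interior_iff_mem_nhds.1 hx)
  refine ⟨min 1 (e / 2 / δ), by positivity, min_le_left _ _, fun w hw => ?_⟩
  have h0 : 0 < min 1 (e / 2 / δ) * δ := by positivity
  have hlt : min 1 (e / 2 / δ) * δ < e := by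
    have := mul_le_mul_of_nonneg_right (min_le_right 1 (e / 2 / δ)) hδ.le
    rw [div_mul_cancel₀ _ hδ.ne'] at this
    linarith
  have hnorm : ‖(min 1 (e / 2 / δ) * δ) • w‖ < e := by
    rwa [norm_smul, hw, mul_one, Real.norm_of_nonneg h0.le]
  constructor <;> apply hball <;> simpa only [mem_ball_iff_norm, add_sub_cancel_left,
    sub_sub_cancel_left, norm_neg] using hnorm

theorem exists_le_stepFraction (hδ : 0 < δ) (hx : x ∈ interior K) :
    ∃ r : ℝ, 0 < r ∧ ∀ w : EuclideanSpace ℝ (Fin d), ‖w‖ = 1 → r ≤ stepFraction K δ x w := by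
  obtain ⟨r, h0, h1, h⟩ := exists_pos_admissible hδ hx
  exact ⟨r, h0, fun w hw => le_stepFraction h0 h1 (h w hw).1 (h w hw).2⟩

theorem stepFraction_pos (hδ : 0 < δ) (hx : x ∈ interior K) (hw : ‖w‖ = 1) :
    0 < stepFraction K δ x w := by
  obtain ⟨r, h0, h⟩ := exists_le_stepFraction hδ hx
  exact h0.trans_le (h w hw)

theorem stepFraction_mem (hK : IsClosed K) (hδ : 0 < δ) (hx : x ∈ interior K) (hw : ‖w‖ = 1) :
    x + (stepFraction K δ x w * δ) • w ∈ K ∧ x - (stepFraction K δ x w * δ) • w ∈ K := by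
  obtain ⟨r, h0, h1, h⟩ := exists_pos_admissible hδ hx
  have hcl : stepFraction K δ x w ∈
      closure {ρ : ℝ | 0 < ρ ∧ ρ ≤ 1 ∧ x + (ρ * δ) • w ∈ K ∧ x - (ρ * δ) • w ∈ K} :=
    csSup_mem_closure ⟨r, h0, h1, h w hw⟩ ⟨1, fun _ h => h.2.1⟩
  -- The condition `0 < ρ` is dropped because it is not closed.
  have hclosed : IsClosed {ρ : ℝ | x + (ρ * δ) • w ∈ K ∧ x - (ρ * δ) • w ∈ K} :=
    (hK.preimage (by fun_prop)).inter (hK.preimage (by fun_prop))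
  exact closure_minimal (fun ρ hρ => hρ.2.2) hclosed hcl

theorem secondDiff_add (u v : EuclideanSpace ℝ (Fin d) → ℝ) :
    secondDiff K δ (u + v) x w = secondDiff K δ u x w + secondDiff K δ v x w := by
  simp only [secondDiff, Pi.add_apply]
  ring

theorem secondDiff_smul (r : ℝ) (u : EuclideanSpace ℝ (Fin d) → ℝ) :
    secondDiff K δ (r • u) x w = r * secondDiff K δ u x w := by
  simp only [secondDiff, Pi.smul_apply, smul_eq_mul]
  ring

theorem secondDiff_sub (u v : EuclideanSpace ℝ (Fin d) → ℝ) :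
    secondDiff K δ (u - v) x w = secondDiff K δ u x w - secondDiff K δ v x w := by
  simp only [secondDiff, Pi.sub_apply]
  ring

theorem secondDiff_const (r : ℝ) : secondDiff K δ (fun _ => r) x w = 0 := by
  simp only [secondDiff]
  ring

theorem secondDiff_mono (hK : IsClosed K) (hδ : 0 < δ) (hx : x ∈ interior K) (hw : ‖w‖ = 1)
    {u v : EuclideanSpace ℝ (Fin d) → ℝ} (huv : ∀ y ∈ K, u y ≤ v y) (hxv : u x = v x) :
    secondDiff K δ u x w ≤ secondDiff K δ v x w := by
  obtain ⟨hp, hm⟩ := stepFraction_mem hK hδ hx hw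
  have h1 := huv _ hp
  have h2 := huv _ hm
  simp only [secondDiff]
  gcongr
  exact hxv.ge

/-- A ball around `x` inside `K` keeps the step away from zero in all directions at once. This
uniformity is what allows an infinite `V`. -/
theorem exists_secondDiff_bound (hK : IsCompact K) (hδ : 0 < δ) (hx : x ∈ interior K)
    {v : EuclideanSpace ℝ (Fin d) → ℝ} (hv : ContinuousOn v K) :
    ∃ M : ℝ, ∀ w : EuclideanSpace ℝ (Fin d), ‖w‖ = 1 → |secondDiff K δ v x w| ≤ M := by
  obtain ⟨B, hB⟩ := hK.exists_bound_of_continuousOn hv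
  obtain ⟨r, hr, hrs⟩ := exists_le_stepFraction hδ hx
  refine ⟨4 * B / (r ^ 2 * δ ^ 2), fun w hw => ?_⟩
  obtain ⟨hp, hm⟩ := stepFraction_mem hK.isClosed hδ hx hw
  have h1 := abs_le.1 (hB _ hp)
  have h2 := abs_le.1 (hB _ hm)
  have h3 := abs_le.1 (hB _ (interior_subset hx))
  have hs := hrs w hw
  have hs0 := hr.trans_le hs
  rw [secondDiff, abs_div, abs_of_pos (show 0 < stepFraction K δ x w ^ 2 * δ ^ 2 by positivity)]
  have h4 : |v (x + (stepFraction K δ x w * δ) • w) - 2 * v x +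
      v (x - (stepFraction K δ x w * δ) • w)| ≤ 4 * B := by
    rw [abs_le]
    constructor <;> linarith
  have h5 := (abs_nonneg _).trans h4
  gcongr

/-- The discrete maximum principle: a piecewise linear function which at each interior node has a
positive second difference is bounded by its values at the boundary nodes. -/
theorem le_of_secondDiff_pos (hfin : T.vertices.Finite) (hK : IsClosed T.space) (hδ : 0 < δ)
    {v : EuclideanSpace ℝ (Fin d) → ℝ} (hv : IsPiecewiseLinear T v) {M : ℝ}
    (hb : ∀ z ∈ boundaryNodes T, v z ≤ M)
    (hi : ∀ z ∈ interiorNodes T, ∃ w : EuclideanSpace ℝ (Fin d), ‖w‖ = 1 ∧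
      0 < secondDiff T.space δ v z w) :
    ∀ x ∈ T.space, v x ≤ M := by
  refine hv.le_of_vertices (isPiecewiseLinear_const M) fun y hy => ?_
  obtain ⟨z, hz, hmax⟩ := exists_max_image T.vertices v hfin ⟨y, hy⟩
  refine (hmax y hy).trans ?_
  by_cases hzi : z ∈ interior T.space
  · obtain ⟨w, hw, hpos⟩ := hi z ⟨hz, hzi⟩
    have hle : ∀ x ∈ T.space, v x ≤ v z :=
      hv.le_of_vertices (isPiecewiseLinear_const (v z)) hmax
    have := secondDiff_mono hK hδ hzi hw hle rfl
    rw [secondDiff_const] at this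
    exact absurd hpos this.not_gt
  · exact hb z ⟨hz, subset_closure (T.vertices_subset_space hz), hzi⟩

theorem quadratic_le_interpolant {a : ℝ} (ha : 0 ≤ a) {Q : EuclideanSpace ℝ (Fin d) → ℝ}
    (hQ : IsPiecewiseLinear T Q) (hQv : ∀ z ∈ T.vertices, Q z = a / 2 * ‖z‖ ^ 2) :
    ∀ x ∈ T.space, a / 2 * ‖x‖ ^ 2 ≤ Q x := by
  intro x hx
  -- The tangent plane of the quadratic at `x`: it lies below the quadratic at the nodes, hence
  -- below `Q` everywhere, and equals the quadratic at `x`.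
  let A : EuclideanSpace ℝ (Fin d) →ᵃ[ℝ] ℝ :=
    (a • (innerSL ℝ x).toLinearMap).toAffineMap - AffineMap.const ℝ _ (a / 2 * ‖x‖ ^ 2)
  have hA : ∀ y, A y = a * inner ℝ x y - a / 2 * ‖x‖ ^ 2 := fun y => by simp [A]
  have h := (isPiecewiseLinear_affine A).le_of_vertices hQ (fun z hz => ?_) x hx
  · rw [hA, real_inner_self_eq_norm_sq] at h
    linarith
  · rw [hA, hQv z hz]
    have := norm_sub_sq_real x z
    nlinarith [sq_nonneg ‖x - z‖]

/-- The centered difference of the quadratic is exactly `a` for any step, and `Q` touches it from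
above at the node. -/
theorem le_secondDiff_interpolant (hK : IsClosed T.space) (hδ : 0 < δ) {a : ℝ} (ha : 0 ≤ a)
    {Q : EuclideanSpace ℝ (Fin d) → ℝ} (hQ : IsPiecewiseLinear T Q)
    (hQv : ∀ z ∈ T.vertices, Q z = a / 2 * ‖z‖ ^ 2) (hx : x ∈ interiorNodes T) (hw : ‖w‖ = 1) :
    a ≤ secondDiff T.space δ Q x w := by
  have h := secondDiff_mono hK hδ hx.2 hw (quadratic_le_interpolant ha hQ hQv) (hQv x hx.1).symm
  refine le_trans (le_of_eq ?_) h
  have hs := stepFraction_pos hδ hx.2 hw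
  rw [secondDiff, eq_div_iff (by positivity), norm_add_sq_real, norm_sub_sq_real, norm_smul, hw,
    Real.norm_of_nonneg (by positivity : 0 ≤ stepFraction T.space δ x w * δ)]
  ring

/-- Upper bound for functions that are convex at each interior node along some direction. -/
theorem le_of_secondDiff_nonneg {Ω : Set (EuclideanSpace ℝ (Fin d))} (hT : IsTriangulation Ω T)
    (hδ : 0 < δ) {a R G : ℝ} (ha : 0 < a) (hR : ∀ z ∈ T.vertices, ‖z‖ ≤ R)
    {v : EuclideanSpace ℝ (Fin d) → ℝ} (hv : IsPiecewiseLinear T v)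
    (hb : ∀ z ∈ boundaryNodes T, v z ≤ G)
    (hi : ∀ z ∈ interiorNodes T, ∃ w : EuclideanSpace ℝ (Fin d), ‖w‖ = 1 ∧
      0 ≤ secondDiff T.space δ v z w) :
    ∀ x ∈ T.space, v x ≤ G + a / 2 * R ^ 2 := by
  have hK := hT.isCompact_space.isClosed
  obtain ⟨Q, hQ, hQv⟩ := exists_interpolant hT fun z => a / 2 * ‖z‖ ^ 2
  have h := le_of_secondDiff_pos (M := G + a / 2 * R ^ 2) hT.finite_vertices hK hδ (hv.add hQ)
    (fun z hz => ?_) fun z hz => ?_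
  · intro x hx
    have h1 := h x hx
    have h2 := quadratic_le_interpolant ha.le hQ hQv x hx
    have h3 : 0 ≤ a / 2 * ‖x‖ ^ 2 := by positivity
    simp only [Pi.add_apply] at h1
    linarith
  · have h1 := hR z hz.1
    rw [Pi.add_apply, hQv z hz.1]
    gcongr
    exact hb z hz
  · obtain ⟨w, hw, h0⟩ := hi z hz
    refine ⟨w, hw, ?_⟩
    rw [secondDiff_add]
    linarith [le_secondDiff_interpolant hK hδ ha.le hQ hQv hz hw]

/-- Lower bound for functions with a bounded second difference at each interior node. -/
theorem neg_le_of_secondDiff_lt {Ω : Set (EuclideanSpace ℝ (Fin d))} (hT : IsTriangulation Ω T)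
    (hδ : 0 < δ) {a R G : ℝ} (ha : 0 < a) (hR : ∀ z ∈ T.vertices, ‖z‖ ≤ R)
    {v : EuclideanSpace ℝ (Fin d) → ℝ} (hv : IsPiecewiseLinear T v)
    (hb : ∀ z ∈ boundaryNodes T, -G ≤ v z)
    (hi : ∀ z ∈ interiorNodes T, ∃ w : EuclideanSpace ℝ (Fin d), ‖w‖ = 1 ∧
      secondDiff T.space δ v z w < a) :
    ∀ x ∈ T.space, -(G + a / 2 * R ^ 2) ≤ v x := by
  have hK := hT.isCompact_space.isClosed
  obtain ⟨Q, hQ, hQv⟩ := exists_interpolant hT fun z => a / 2 * ‖z‖ ^ 2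
  have h := le_of_secondDiff_pos (M := a / 2 * R ^ 2 + G) hT.finite_vertices hK hδ (hQ.sub hv)
    (fun z hz => ?_) fun z hz => ?_
  · intro x hx
    have h1 := h x hx
    have h2 := quadratic_le_interpolant ha.le hQ hQv x hx
    have h3 : 0 ≤ a / 2 * ‖x‖ ^ 2 := by positivity
    simp only [Pi.sub_apply] at h1
    linarith
  · have h1 := hR z hz.1
    have h2 : a / 2 * ‖z‖ ^ 2 ≤ a / 2 * R ^ 2 := by gcongr
    rw [Pi.sub_apply, hQv z hz.1]
    linarith [hb z hz]
  · obtain ⟨w, hw, h0⟩ := hi z hz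
    refine ⟨w, hw, ?_⟩
    rw [secondDiff_sub]
    linarith [le_secondDiff_interpolant hK hδ ha.le hQ hQv hz hw]

/-! ### The Monge–Ampère operator. -/

/-- The Monge–Ampère integrand as a function of the second differences. -/
def maIntegrand (s : Fin d → ℝ) : ℝ := (∏ i, max (s i) 0) - ∑ i, max (-s i) 0

theorem maIntegrand_mono : Monotone (maIntegrand (d := d)) := fun s t hst => by
  refine sub_le_sub (Finset.prod_le_prod (fun _ _ => le_max_right _ _) fun i _ => ?_)
    (Finset.sum_le_sum fun i _ => ?_)
  · exact max_le_max_right 0 (hst i)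
  · exact max_le_max_right 0 (neg_le_neg (hst i))

theorem continuous_maIntegrand : Continuous (maIntegrand (d := d)) := by
  unfold maIntegrand
  fun_prop

theorem maIntegrand_const {a : ℝ} (ha : 0 ≤ a) : maIntegrand (fun _ : Fin d => a) = a ^ d := by
  simp [maIntegrand, ha]

/-- One negative entry kills the product and leaves a strictly negative penalty. -/
theorem nonneg_of_maIntegrand_nonneg {s : Fin d → ℝ} (h : 0 ≤ maIntegrand s) (i : Fin d) :
    0 ≤ s i := by
  by_contra! hi
  have h1 : ∏ j, max (s j) 0 = 0 :=
    Finset.prod_eq_zero (Finset.mem_univ i) (max_eq_right hi.le)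
  have h2 : max (-s i) 0 ≤ ∑ j, max (-s j) 0 :=
    Finset.single_le_sum (f := fun j => max (-s j) 0) (fun _ _ => le_max_right _ _)
      (Finset.mem_univ i)
  rw [maIntegrand, h1] at h
  linarith [le_max_left (-s i) 0]

theorem IsDirectionSet.nonempty {θ : ℝ} {V : Set (Fin d → EuclideanSpace ℝ (Fin d))}
    (hV : IsDirectionSet θ V) : V.Nonempty := by
  obtain ⟨w, hw, -⟩ := hV.approx _ (EuclideanSpace.basisFun (Fin d) ℝ).orthonormal
  exact ⟨w, hw⟩

variable {V : Set (Fin d → EuclideanSpace ℝ (Fin d))} {θ : ℝ}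

/-- Needed because `sInf` of a set unbounded below is the default value `0`. -/
theorem bddBelow_maIntegrand (hV : IsDirectionSet θ V) (hK : IsCompact K) (hδ : 0 < δ)
    (hx : x ∈ interior K) {v : EuclideanSpace ℝ (Fin d) → ℝ} (hv : ContinuousOn v K) :
    BddBelow ((fun w => maIntegrand fun i => secondDiff K δ v x (w i)) '' V) := by
  obtain ⟨M, hM⟩ := exists_secondDiff_bound hK hδ hx hv
  refine ⟨maIntegrand fun _ : Fin d => -M, ?_⟩
  rintro _ ⟨w, hw, rfl⟩
  exact maIntegrand_mono fun i => (abs_le.1 (hM _ (hV.unit w hw i))).1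

theorem maOp_le (hV : IsDirectionSet θ V) (hK : IsCompact K) (hδ : 0 < δ)
    (hx : x ∈ interior K) {v : EuclideanSpace ℝ (Fin d) → ℝ} (hv : ContinuousOn v K)
    {w : Fin d → EuclideanSpace ℝ (Fin d)} (hw : w ∈ V) :
    maOp K δ V v x ≤ maIntegrand fun i => secondDiff K δ v x (w i) :=
  csInf_le (bddBelow_maIntegrand hV hK hδ hx hv) ⟨w, hw, rfl⟩

theorem le_maOp (hV : IsDirectionSet θ V) {v : EuclideanSpace ℝ (Fin d) → ℝ} {r : ℝ}
    (h : ∀ w ∈ V, r ≤ maIntegrand fun i => secondDiff K δ v x (w i)) : r ≤ maOp K δ V v x := by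
  refine le_csInf (hV.nonempty.image _) ?_
  rintro _ ⟨w, hw, rfl⟩
  exact h w hw

theorem exists_secondDiff_lt_of_maOp_lt (hV : IsDirectionSet θ V)
    {v : EuclideanSpace ℝ (Fin d) → ℝ} {a : ℝ} (ha : 0 ≤ a) (h : maOp K δ V v x < a ^ d) :
    ∃ w : EuclideanSpace ℝ (Fin d), ‖w‖ = 1 ∧ secondDiff K δ v x w < a := by
  by_contra! hc
  refine h.not_ge (le_maOp hV fun w hw => ?_)
  rw [← maIntegrand_const ha]
  exact maIntegrand_mono fun i => hc _ (hV.unit w hw i)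

end TwoScale

/-! ### Existence by Perron's method, and stability. -/

namespace TwoScale

variable {d : ℕ} {T : Geometry.SimplicialComplex ℝ (EuclideanSpace ℝ (Fin d))}
  {K : Set (EuclideanSpace ℝ (Fin d))} {δ : ℝ} {x w : EuclideanSpace ℝ (Fin d)}
  {V : Set (Fin d → EuclideanSpace ℝ (Fin d))} {θ : ℝ}

/-- A strict lower bound for the operator survives a small perturbation, uniformly in the
directions. -/
theorem exists_pos_le_maIntegrand_add (hV : IsDirectionSet θ V) (hK : IsCompact K) (hδ : 0 < δ)
    (hx : x ∈ interior K) {u v : EuclideanSpace ℝ (Fin d) → ℝ} (hu : ContinuousOn u K)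
    (hv : ContinuousOn v K) {r : ℝ} (hr : r < maOp K δ V u x) :
    ∃ t : ℝ, 0 < t ∧ ∀ w ∈ V, r ≤ maIntegrand fun i => secondDiff K δ (u + t • v) x (w i) := by
  obtain ⟨M, hM⟩ := exists_secondDiff_bound hK hδ hx hu
  obtain ⟨N, hN⟩ := exists_secondDiff_bound hK hδ hx hv
  -- The box contains the second differences of `u + t • v` for all `0 ≤ t ≤ 1` and all directions,
  -- so one `η` serves every `w ∈ V`.
  have hunif : UniformContinuousOn (maIntegrand (d := d))
      (Icc (fun _ => -(M + |N|)) fun _ => M + |N|) :=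
    isCompact_Icc.uniformContinuousOn_of_continuous continuous_maIntegrand.continuousOn
  obtain ⟨η, hη, hclose⟩ := Metric.uniformContinuousOn_iff.1 hunif _ (sub_pos.2 hr)
  have hN0 : 0 < |N| + 1 := by positivity
  have ht0 : 0 < min 1 (η / 2 / (|N| + 1)) := by positivity
  refine ⟨min 1 (η / 2 / (|N| + 1)), ht0, fun w hw => ?_⟩
  generalize ht : min 1 (η / 2 / (|N| + 1)) = t at ht0
  have ht1 : t ≤ 1 := ht ▸ min_le_left _ _
  have htη : t * (|N| + 1) ≤ η / 2 := by
    rw [← le_div_iff₀ hN0]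
    exact ht ▸ min_le_right _ _
  have hNw : ∀ i, |secondDiff K δ v x (w i)| ≤ |N| := fun i =>
    (hN _ (hV.unit w hw i)).trans (le_abs_self N)
  have htv : ∀ i, |t * secondDiff K δ v x (w i)| ≤ t * |N| := fun i => by
    rw [abs_mul, abs_of_pos ht0]
    exact mul_le_mul_of_nonneg_left (hNw i) ht0.le
  have htN : t * |N| ≤ |N| := mul_le_of_le_one_left (abs_nonneg N) ht1
  have hMw : ∀ i, |secondDiff K δ u x (w i)| ≤ M := fun i => hM _ (hV.unit w hw i)
  simp only [secondDiff_add, secondDiff_smul]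
  have hd := hclose (fun i => secondDiff K δ u x (w i))
    ⟨fun i => by linarith [abs_le.1 (hMw i), abs_nonneg N],
      fun i => by linarith [abs_le.1 (hMw i), abs_nonneg N]⟩
    (fun i => secondDiff K δ u x (w i) + t * secondDiff K δ v x (w i))
    ⟨fun i => by linarith [abs_le.1 (hMw i), abs_le.1 (htv i)],
      fun i => by linarith [abs_le.1 (hMw i), abs_le.1 (htv i)]⟩
    ((dist_pi_lt_iff hη).2 fun i => by
      rw [dist_self_add_right, Real.norm_eq_abs]
      linarith [htv i])
  rw [Real.dist_eq] at hd
  linarith [(abs_lt.1 hd).2, maOp_le hV hK hδ hx hu hw]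

theorem exists_isSolution (hd : 1 ≤ d) {Ω : Set (EuclideanSpace ℝ (Fin d))}
    (hT : IsTriangulation Ω T) (hδ : 0 < δ) (hV : IsDirectionSet θ V)
    {f g : EuclideanSpace ℝ (Fin d) → ℝ} {a R G : ℝ} (ha : 0 < a)
    (hR : ∀ z ∈ T.vertices, ‖z‖ ≤ R) (hf : ∀ z ∈ interiorNodes T, 0 ≤ f z)
    (hfa : ∀ z ∈ interiorNodes T, f z ≤ a ^ d) (hG : 0 ≤ G)
    (hg : ∀ z ∈ boundaryNodes T, |g z| ≤ G) : ∃ u, IsSolution T δ V f g u := by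
  classical
  have hfin := hT.finite_vertices
  have hK := hT.isCompact_space
  obtain ⟨I, hI, hIv, hIc⟩ := exists_interpolation hT
  let B := G + a / 2 * R ^ 2
  have hBeq : B = G + a / 2 * R ^ 2 := rfl
  have hB : 0 ≤ B := by positivity
  -- Subsolutions, as functions of which only the nodal values matter. Asking for the inequality for
  -- each `w`, not for the infimum, makes closedness immediate.
  let S : Set (EuclideanSpace ℝ (Fin d) → ℝ) :=
    {c | (∀ z ∈ boundaryNodes T, c z ≤ g z) ∧ ∀ z ∈ interiorNodes T, ∀ w ∈ V,
      f z ≤ maIntegrand fun i => secondDiff T.space δ (I c) z (w i)}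
  have hS_closed : IsClosed S := by
    have hsd : ∀ z w : EuclideanSpace ℝ (Fin d),
        Continuous fun c => secondDiff T.space δ (I c) z w := fun z w => by
      have h : ∀ y, Continuous fun c => I c y := fun y => (continuous_apply y).comp hIc
      unfold secondDiff
      exact (((h _).sub (continuous_const.mul (h _))).add (h _)).div_const _
    refine IsClosed.and ?_ ?_
    · simp only [ofPred_forall]
      exact isClosed_biInter fun z _ => isClosed_le (continuous_apply z) continuous_const
    · simp only [ofPred_forall]
      exact isClosed_biInter fun z _ => isClosed_biInter fun w _ =>
        isClosed_le continuous_const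
          (continuous_maIntegrand.comp (continuous_pi fun i => hsd z (w i)))
  have hS_le : ∀ c ∈ S, ∀ z ∈ T.vertices, c z ≤ B := by
    intro c hc z hz
    rw [← hIv c z hz]
    refine le_of_secondDiff_nonneg hT hδ ha hR (hI c) (fun y hy => ?_) (fun y hy => ?_) z
      (T.vertices_subset_space hz)
    · rw [hIv c y hy.1]
      exact (hc.1 y hy).trans (abs_le.1 (hg y hy)).2
    · obtain ⟨w, hw⟩ := hV.nonempty
      exact ⟨w ⟨0, hd⟩, hV.unit w hw _,
        nonneg_of_maIntegrand_nonneg ((hf y hy).trans (hc.2 y hy w hw)) ⟨0, hd⟩⟩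
  have hcompact : IsCompact (Icc (fun _ => -B) (fun _ => B) ∩ S) :=
    isCompact_Icc.inter_right hS_closed
  -- The witness is the quadratic lowered by `B`, which puts it below `-G` at the boundary nodes; it
  -- is cut off to `0` away from the nodes to stay in the box.
  have hne : (Icc (fun _ => -B) (fun _ => B) ∩ S).Nonempty := by
    have hq : ∀ z ∈ T.vertices, a / 2 * ‖z‖ ^ 2 ≤ a / 2 * R ^ 2 := fun z hz => by
      have := hR z hz
      gcongr
    have hval : ∀ z ∈ T.vertices,
        T.vertices.indicator (fun z => a / 2 * ‖z‖ ^ 2 - B) z = a / 2 * ‖z‖ ^ 2 - B :=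
      fun z hz => indicator_of_mem hz _
    refine ⟨T.vertices.indicator fun z => a / 2 * ‖z‖ ^ 2 - B, ⟨fun z => ?_, fun z => ?_⟩,
      fun z hz => ?_, fun z hz w hw => ?_⟩
    · by_cases hz : z ∈ T.vertices
      · have : 0 ≤ a / 2 * ‖z‖ ^ 2 := by positivity
        rw [hval z hz]
        linarith
      · simpa [hz] using hB
    · by_cases hz : z ∈ T.vertices
      · rw [hval z hz]
        change _ ≤ B
        linarith [hq z hz]
      · simpa [hz] using hB
    · rw [hval z hz.1]
      linarith [hq z hz.1, (abs_le.1 (hg z hz)).1]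
    · refine (hfa z hz).trans ?_
      rw [← maIntegrand_const ha.le]
      refine maIntegrand_mono fun i => ?_
      have h := le_secondDiff_interpolant hK.isClosed hδ ha.le
        ((hI (T.vertices.indicator fun z => a / 2 * ‖z‖ ^ 2 - B)).add (isPiecewiseLinear_const B))
        (fun y hy => by rw [Pi.add_apply, hIv _ y hy, hval y hy]; ring) hz (hV.unit w hw i)
      rwa [secondDiff_add, secondDiff_const, add_zero] at h
  obtain ⟨c, ⟨hcI, hc⟩, hmax⟩ := hcompact.exists_isMaxOn hne
    (f := fun c => ∑ z ∈ hfin.toFinset, c z) (by fun_prop)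
  have hsingle : ∀ z y : EuclideanSpace ℝ (Fin d), 0 ≤ (Pi.single z 1 : _ → ℝ) y := fun z y => by
    by_cases h : y = z
    · subst h; simp
    · simp [h]
  -- The box is no obstacle to raising a node: its upper bound holds at nodes for all of `S` by
  -- `hS_le`, and the lower one is preserved.
  have hraise : ∀ z ∈ T.vertices, ∀ t : ℝ, 0 < t → c + t • Pi.single z 1 ∉ S := by
    intro z hz t ht hmem
    have hge : ∀ y, c y ≤ (c + t • Pi.single z 1 : _ → ℝ) y := fun y => by
      simpa using mul_nonneg ht.le (hsingle z y)
    have h1 : c + t • Pi.single z 1 ∈ Icc (fun _ => -B) (fun _ => B) := by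
      refine ⟨fun y => (hcI.1 y).trans (hge y), fun y => ?_⟩
      by_cases h : y = z
      · exact h ▸ hS_le _ hmem z hz
      · simpa [h] using hcI.2 y
    have h2 := hmax ⟨h1, hmem⟩
    refine absurd h2 (not_le.2 (Finset.sum_lt_sum (fun y _ => hge y)
      ⟨z, hfin.mem_toFinset.2 hz, by simpa using ht⟩))
  have hmono : ∀ z, ∀ t : ℝ, 0 < t → ∀ y ∈ interiorNodes T, y ≠ z → ∀ w ∈ V,
      f y ≤ maIntegrand fun i => secondDiff T.space δ (I (c + t • Pi.single z 1)) y (w i) := by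
    intro z t ht y hy hyz w hw
    refine (hc.2 y hy w hw).trans (maIntegrand_mono fun i => ?_)
    refine secondDiff_mono hK.isClosed hδ hy.2 (hV.unit w hw i)
      ((hI _).le_of_vertices (hI _) fun p hp => ?_) ?_
    · rw [hIv _ p hp, hIv _ p hp]
      simpa using mul_nonneg ht.le (hsingle z p)
    · rw [hIv _ y hy.1, hIv _ y hy.1]
      simp [hyz]
  have hdisj : ∀ y ∈ boundaryNodes T, ∀ z ∈ interiorNodes T, y ≠ z := by
    rintro y hy z hz rfl
    exact hy.2.2 hz.2
  refine ⟨I c, hI c, fun z hz => ?_, fun z hz => ?_⟩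
  · refine le_antisymm ?_ (le_maOp hV (hc.2 z hz))
    by_contra! hlt
    obtain ⟨t, ht, htw⟩ := exists_pos_le_maIntegrand_add hV hK hδ hz.2 (hI c).1
      (hI (Pi.single z 1)).1 hlt
    refine hraise z hz.1 t ht ⟨fun y hy => ?_, fun y hy w hw => ?_⟩
    · simpa [hdisj y hy z hz] using hc.1 y hy
    · by_cases hyz : y = z
      · subst hyz
        rw [map_add, map_smul]
        exact htw w hw
      · exact hmono z t ht y hy hyz w hw
  · rw [hIv c z hz.1]
    refine le_antisymm (hc.1 z hz) ?_
    by_contra! hlt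
    refine hraise z hz.1 (g z - c z) (sub_pos.2 hlt) ⟨fun y hy => ?_, fun y hy w hw => ?_⟩
    · by_cases hyz : y = z
      · subst hyz; simp
      · simpa [hyz] using hc.1 y hy
    · exact hmono z _ (sub_pos.2 hlt) y hy (hdisj z hz y hy).symm w hw

theorem IsSolution.abs_le (hd : 1 ≤ d) {Ω : Set (EuclideanSpace ℝ (Fin d))}
    (hT : IsTriangulation Ω T) (hδ : 0 < δ) (hV : IsDirectionSet θ V)
    {f g : EuclideanSpace ℝ (Fin d) → ℝ} {a R G : ℝ} (ha : 0 < a)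
    (hR : ∀ z ∈ T.vertices, ‖z‖ ≤ R) (hf : ∀ z ∈ interiorNodes T, 0 ≤ f z)
    (hfa : ∀ z ∈ interiorNodes T, f z < a ^ d)
    (hg : ∀ z ∈ boundaryNodes T, |g z| ≤ G) {u : EuclideanSpace ℝ (Fin d) → ℝ}
    (hu : IsSolution T δ V f g u) : ∀ x ∈ T.space, |u x| ≤ G + a / 2 * R ^ 2 := by
  refine fun x hx => _root_.abs_le.2 ⟨neg_le_of_secondDiff_lt hT hδ ha hR hu.piecewiseLinear
    (fun z hz => ?_) (fun z hz => ?_) x hx, le_of_secondDiff_nonneg hT hδ ha hR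
    hu.piecewiseLinear (fun z hz => ?_) (fun z hz => ?_) x hx⟩
  · rw [hu.boundary_eq z hz]
    exact (_root_.abs_le.1 (hg z hz)).1
  · refine exists_secondDiff_lt_of_maOp_lt hV ha.le ?_
    rw [hu.interior_eq z hz]
    exact hfa z hz
  · rw [hu.boundary_eq z hz]
    exact (_root_.abs_le.1 (hg z hz)).2
  · obtain ⟨w, hw⟩ := hV.nonempty
    have h := maOp_le hV hT.isCompact_space hδ hz.2 hu.piecewiseLinear.1 hw
    rw [hu.interior_eq z hz] at h
    exact ⟨w ⟨0, hd⟩, hV.unit w hw _,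
      nonneg_of_maIntegrand_nonneg ((hf z hz).trans h) ⟨0, hd⟩⟩

end TwoScale

theorem mainTheorem9 (d : ℕ) (hd : 1 ≤ d)
    (Ω : Set (EuclideanSpace ℝ (Fin d))) (hΩ_open : IsOpen Ω) (hΩ_convex : Convex ℝ Ω)
    (hΩ_bounded : Bornology.IsBounded Ω)
    (f g : EuclideanSpace ℝ (Fin d) → ℝ)
    (hf : ContinuousOn f (closure Ω)) (hf_nonneg : ∀ x ∈ closure Ω, 0 ≤ f x)
    (hg : ContinuousOn g (frontier Ω)) :
    ∃ C : ℝ, ∀ h δ θ σ : ℝ, 0 < h → 0 < δ → 0 < θ → 0 < σ →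
      ∀ T : Geometry.SimplicialComplex ℝ (EuclideanSpace ℝ (Fin d)),
        TwoScale.IsTriangulation Ω T → TwoScale.IsQuasiUniform T h σ →
      ∀ V : Set (Fin d → EuclideanSpace ℝ (Fin d)), TwoScale.IsDirectionSet θ V →
        (∃ u : EuclideanSpace ℝ (Fin d) → ℝ, TwoScale.IsSolution T δ V f g u) ∧
        ∀ u : EuclideanSpace ℝ (Fin d) → ℝ, TwoScale.IsSolution T δ V f g u →
          ∀ x ∈ T.space, |u x| ≤ C := by

  have hcl : IsCompact (closure Ω) := hΩ_bounded.isCompact_closure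
  obtain ⟨F, hF⟩ := hcl.exists_bound_of_continuousOn hf
  obtain ⟨G, hG⟩ := (hcl.of_isClosed_subset isClosed_frontier
    frontier_subset_closure).exists_bound_of_continuousOn hg
  obtain ⟨R, hR⟩ := hcl.isBounded.exists_norm_le
  -- With `a = |F| + 1 ≥ 1` and `d ≥ 1`, `f ≤ F < a ≤ a ^ d`.
  have ha : 1 ≤ |F| + 1 := by linarith [abs_nonneg F]
  refine ⟨|G| + (|F| + 1) / 2 * R ^ 2, fun h δ θ σ _ hδ _ _ T hT _ V hV => ?_⟩
  have hRv : ∀ z ∈ T.vertices, ‖z‖ ≤ R := fun z hz => hR z (hT.nodes_subset hz)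
  have hf0 : ∀ z ∈ TwoScale.interiorNodes T, 0 ≤ f z := fun z hz =>
    hf_nonneg z (hT.nodes_subset hz.1)
  have hfa : ∀ z ∈ TwoScale.interiorNodes T, f z < (|F| + 1) ^ d := fun z hz =>
    calc f z ≤ F := (le_abs_self _).trans (hF z (hT.nodes_subset hz.1))
      _ < |F| + 1 := by linarith [le_abs_self F]
      _ ≤ (|F| + 1) ^ d := le_self_pow₀ ha (by omega)
  have hgG : ∀ z ∈ TwoScale.boundaryNodes T, |g z| ≤ |G| := fun z hz =>
    (hG z (hT.boundary_nodes z hz.1 hz.2)).trans (le_abs_self G)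
  exact ⟨TwoScale.exists_isSolution hd hT hδ hV (by positivity) hRv hf0
    (fun z hz => (hfa z hz).le) (abs_nonneg G) hgG,
    fun u hu => hu.abs_le hd hT hδ hV (by positivity) hRv hf0 hfa hgG⟩
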